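/- Let $K>0$ and $c>0$, and let $\mathcal H=\mathbb C\times L^2(0,1)$ be the complex Hilbert space with norm $\|(\vartheta,w)\|_{\mathcal H}^2=|\vartheta|^2+\int_0^1|w(x)|^2\,dx$. Let $\mathcal A_w$ be the unbounded operator on $\mathcal H$ given by $$\mathcal A_w(\vartheta,w)=\big(-K\vartheta+w(0),\,-i\,w''-c\,w\big),\qquad D(\mathcal A_w)=\{(\vartheta,w)\in\mathbb C\times H^2(0,1)\;:\;w(1)=0,\ w'(0)=0\}.$$ Then there is a sequence $(Z_n)_{n\ge 0}$ of eigenfunctions (eigenvectors) of $\mathcal A_w$ which forms a Riesz basis of $\mathcal H$, that is, $(Z_n)$ is the image of the standard orthonormal basis of $\ell^2$ under a bounded operator $\ell^2\to\mathcal H$ with bounded inverse; moreover this sequence can be chosen quadratically close to an orthogonal basis $(F_n)_{n\ge 0}$ of $\mathcal H$, i.e. $\sum_{n\ge 0}\|Z_n-F_n\|_{\mathcal H}^2<\infty$. Furthermore, $\mathcal A_w$ is the infinitesimal generator of an exponentially stable $C_0$-semigroup $(e^{\mathcal A_w t})_{t\ge 0}$ on $\mathcal H$: there exists $M\ge 1$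 such that $$\|e^{\mathcal A_w t}\|_{\mathcal L(\mathcal H)}\le M e^{-\alpha t}\quad\text{for all } t\ge 0,\qquad \alpha=\min\{K,c\}.$$ -/

import Mathlib

open MeasureTheory Set Filter Topology
open scoped ContDiff

noncomputable section

/-- A sequence is a Riesz basis of a Hilbert space: it is the image of the standard orthonormal
basis of `ℓ²(ℕ)` under a bounded, boundedly invertible operator. -/
def IsRieszBasis {H : Type*} [NormedAddCommGroup H] [InnerProductSpace ℂ H] (Z : ℕ → H) : Prop :=
  ∃ S : lp (fun _ : ℕ => ℂ) 2 ≃L[ℂ] H, ∀ n, Z n = S (lp.single 2 n (1 : ℂ))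

/-- A sequence is an orthogonal basis of a Hilbert space: its members are nonzero, pairwise
orthogonal, and their linear span is dense. -/
def IsOrthogonalBasis {H : Type*} [NormedAddCommGroup H] [InnerProductSpace ℂ H]
    (F : ℕ → H) : Prop :=
  (∀ n, F n ≠ 0) ∧ (∀ m n, m ≠ n → inner ℂ (F m) (F n) = 0) ∧
    Dense (Submodule.span ℂ (Set.range F) : Set H)

/-- `x` is an eigenvector (eigenfunction) of the unbounded operator `A`. -/
def IsEigenvector {H : Type*} [AddCommGroup H] [Module ℂ H] (A : H →ₗ.[ℂ] H) (x : H) : Prop :=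
  x ≠ 0 ∧ ∃ (hx : x ∈ A.domain) (l : ℂ), A ⟨x, hx⟩ = l • x

/-- `T` (restricted to `t ≥ 0`) is a strongly continuous one-parameter semigroup of bounded
operators. -/
structure IsC0Semigroup {H : Type*} [NormedAddCommGroup H] [NormedSpace ℂ H]
    (T : ℝ → H →L[ℂ] H) : Prop where
  zero : T 0 = ContinuousLinearMap.id ℂ H
  add : ∀ s t : ℝ, 0 ≤ s → 0 ≤ t → T (s + t) = (T s).comp (T t)
  strong_cont : ∀ x : H, Tendsto (fun t : ℝ => T t x) (𝓝[>] 0) (𝓝 x)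

/-- The unbounded operator `A`, with exactly its domain, is the infinitesimal generator of `T`:
`x ∈ D(A)` and `A x = y` if and only if `(T t x - x) / t → y` as `t ↓ 0`. -/
def IsInfinitesimalGenerator {H : Type*} [NormedAddCommGroup H] [NormedSpace ℂ H]
    (A : H →ₗ.[ℂ] H) (T : ℝ → H →L[ℂ] H) : Prop :=
  ∀ x y : H, (x, y) ∈ A.graph ↔
    Tendsto (fun t : ℝ => ((t : ℂ)⁻¹) • (T t x - x)) (𝓝[>] 0) (𝓝 y)

/-- The complex space `L²(0,1)`. -/
abbrev L2I : Type := Lp ℂ 2 (volume.restrict (Ioo (0 : ℝ) 1))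

/-- The state space `ℂ × L²(0,1)` with the norm `‖(ϑ, w)‖² = |ϑ|² + ∫₀¹ |w|²`. -/
abbrev StateSpace : Type := WithLp 2 (ℂ × L2I)

/-- `v ∈ L²(0,1)` is the weak derivative of `w ∈ L²(0,1)`. -/
def IsWeakDeriv (w v : L2I) : Prop :=
  ∀ φ : ℝ → ℝ, ContDiff ℝ ∞ φ → HasCompactSupport φ → tsupport φ ⊆ Ioo (0 : ℝ) 1 →
    ∫ x in Ioo (0 : ℝ) 1, deriv φ x • w x = - ∫ x in Ioo (0 : ℝ) 1, φ x • v x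

/-- The value at `x ∈ [0,1]` of the continuous representative of `w` on `[0,1]` is `a`
(every `w ∈ H¹(0,1)` has exactly one such representative). -/
def HasValueAt (w : L2I) (x : ℝ) (a : ℂ) : Prop :=
  ∃ f : ℝ → ℂ, ContinuousOn f (Icc 0 1) ∧ w =ᵐ[volume.restrict (Ioo (0 : ℝ) 1)] f ∧ f x = a

theorem integral_smul_zero_L2I (ψ : ℝ → ℝ) :
    ∫ x in Ioo (0 : ℝ) 1, ψ x • (0 : L2I) x = 0 := by
  apply integral_eq_zero_of_ae
  filter_upwards [Lp.coeFn_zero ℂ 2 (volume.restrict (Ioo (0 : ℝ) 1))] with x hx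
  simp only [hx, Pi.zero_apply, smul_zero]

theorem IsWeakDeriv.zero : IsWeakDeriv 0 0 := by
  intro φ _ _ _
  rw [integral_smul_zero_L2I, integral_smul_zero_L2I, neg_zero]

theorem integrable_smul_L2I {φ : ℝ → ℝ} (hφ : Continuous φ) (hs : HasCompactSupport φ)
    (w : L2I) : Integrable (fun x => φ x • w x) (volume.restrict (Ioo (0 : ℝ) 1)) := by
  obtain ⟨C, hC⟩ := hs.exists_bound_of_continuous hφ
  have hw : Integrable w (volume.restrict (Ioo (0 : ℝ) 1)) :=
    (Lp.memLp w).integrable (by norm_num)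
  exact hw.bdd_smul C hφ.aestronglyMeasurable (Eventually.of_forall hC)

theorem IsWeakDeriv.add {w v w' v' : L2I} (h : IsWeakDeriv w v) (h' : IsWeakDeriv w' v') :
    IsWeakDeriv (w + w') (v + v') := by
  intro φ hφ hs ht
  have e (ψ : ℝ → ℝ) (hψ : Continuous ψ) (hψs : HasCompactSupport ψ) (u u' : L2I) :
      ∫ x in Ioo (0 : ℝ) 1, ψ x • (u + u' : L2I) x =
        (∫ x in Ioo (0 : ℝ) 1, ψ x • u x) + ∫ x in Ioo (0 : ℝ) 1, ψ x • u' x := by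
    rw [← integral_add (integrable_smul_L2I hψ hψs u) (integrable_smul_L2I hψ hψs u')]
    apply integral_congr_ae
    filter_upwards [Lp.coeFn_add u u'] with x hx
    rw [hx, Pi.add_apply, smul_add]
  rw [e _ (hφ.continuous_deriv (by simp)) hs.deriv, e _ hφ.continuous hs, h φ hφ hs ht,
    h' φ hφ hs ht, neg_add]

theorem IsWeakDeriv.smul {w v : L2I} (h : IsWeakDeriv w v) (a : ℂ) :
    IsWeakDeriv (a • w) (a • v) := by
  intro φ hφ hs ht
  have e (ψ : ℝ → ℝ) (u : L2I) :
      ∫ x in Ioo (0 : ℝ) 1, ψ x • (a • u : L2I) x =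
        a • ∫ x in Ioo (0 : ℝ) 1, ψ x • u x := by
    rw [← integral_smul]
    apply integral_congr_ae
    filter_upwards [Lp.coeFn_smul a u] with x hx
    rw [hx, Pi.smul_apply, smul_comm]
  rw [e, e, h φ hφ hs ht, smul_neg]

theorem HasValueAt.zero (x : ℝ) : HasValueAt 0 x 0 :=
  ⟨fun _ => 0, continuousOn_const, Lp.coeFn_zero ℂ 2 _, rfl⟩

theorem HasValueAt.add {w w' : L2I} {x : ℝ} {a a' : ℂ} (h : HasValueAt w x a)
    (h' : HasValueAt w' x a') : HasValueAt (w + w') x (a + a') := by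
  obtain ⟨f, hf, hw, rfl⟩ := h
  obtain ⟨f', hf', hw', rfl⟩ := h'
  exact ⟨f + f', hf.add hf', (Lp.coeFn_add w w').trans (hw.add hw'), rfl⟩

theorem HasValueAt.smul {w : L2I} {x : ℝ} {a : ℂ} (h : HasValueAt w x a) (b : ℂ) :
    HasValueAt (b • w) x (b • a) := by
  obtain ⟨f, hf, hw, rfl⟩ := h
  exact ⟨b • f, hf.const_smul b, (Lp.coeFn_smul b w).trans (hw.const_smul b), rfl⟩

/-- The graph of the operator `A_w (ϑ, w) = (-K ϑ + w(0), -i w'' - c w)` whose domain consists of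
the `(ϑ, w) ∈ ℂ × H²(0,1)` with `w(1) = 0` and `w'(0) = 0`; here `v = w'` and `z = w''`. -/
def targetGraph (K c : ℝ) : Submodule ℂ (StateSpace × StateSpace) where
  carrier := {p | ∃ (v z : L2I) (a : ℂ), IsWeakDeriv p.1.snd v ∧ IsWeakDeriv v z ∧
    HasValueAt p.1.snd 1 0 ∧ HasValueAt v 0 0 ∧ HasValueAt p.1.snd 0 a ∧
    p.2 = WithLp.toLp 2
      (-(K : ℂ) * p.1.fst + a, -Complex.I • z - (c : ℂ) • p.1.snd)}
  add_mem' := by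
    rintro ⟨p, p'⟩ ⟨q, q'⟩ ⟨v, z, a, h1, h2, h3, h4, h5, h6⟩ ⟨v', z', a', g1, g2, g3, g4, g5, g6⟩
    refine ⟨v + v', z + z', a + a', h1.add g1, h2.add g2, ?_, ?_, h5.add g5, ?_⟩
    · simpa using h3.add g3
    · simpa using h4.add g4
    · simp only at h6 g6
      simp only [Prod.mk_add_mk, h6, g6, ← WithLp.toLp_add, WithLp.add_fst, WithLp.add_snd,
        smul_add]
      congr 2
      · ring
      · abel
  zero_mem' := by
    refine ⟨0, 0, 0, IsWeakDeriv.zero, IsWeakDeriv.zero, HasValueAt.zero 1, HasValueAt.zero 0,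
      HasValueAt.zero 0, ?_⟩
    simp only [Prod.fst_zero, Prod.snd_zero, WithLp.zero_fst, WithLp.zero_snd, mul_zero, add_zero,
      smul_zero, sub_zero]
    rfl
  smul_mem' := by
    rintro b ⟨p, p'⟩ ⟨v, z, a, h1, h2, h3, h4, h5, h6⟩
    refine ⟨b • v, b • z, b • a, h1.smul b, h2.smul b, ?_, ?_, h5.smul b, ?_⟩
    · simpa using h3.smul b
    · simpa using h4.smul b
    · simp only at h6
      simp only [Prod.smul_mk, h6, ← WithLp.toLp_smul, WithLp.smul_fst, WithLp.smul_snd,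
        smul_sub, smul_eq_mul]
      congr 2
      · ring
      · rw [smul_comm b, smul_comm b]

theorem IsWeakDeriv.eq_zero {v : L2I} (h : IsWeakDeriv 0 v) : v = 0 := by
  have hv : LocallyIntegrableOn v (Ioo (0 : ℝ) 1) volume :=
    IntegrableOn.locallyIntegrableOn ((Lp.memLp v).integrable (by norm_num))
  have key := isOpen_Ioo.ae_eq_zero_of_integral_contDiff_smul_eq_zero hv (fun φ hφ hs ht => by
    have h1 := h φ hφ hs ht
    rw [integral_smul_zero_L2I, zero_eq_neg] at h1
    rw [← h1, setIntegral_eq_integral_of_forall_compl_eq_zero]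
    intro x hx
    rw [image_eq_zero_of_notMem_tsupport (fun hx' => hx (ht hx')), zero_smul])
  rw [Lp.eq_zero_iff_ae_eq_zero]
  exact (ae_restrict_iff' measurableSet_Ioo).2 key

theorem HasValueAt.eq_zero {x : ℝ} (hx : x ∈ Icc (0 : ℝ) 1) {a : ℂ} (h : HasValueAt 0 x a) :
    a = 0 := by
  obtain ⟨f, hf, hw, rfl⟩ := h
  have h0 : f =ᵐ[volume.restrict (Icc (0 : ℝ) 1)] fun _ => (0 : ℂ) := by
    rw [← Measure.restrict_congr_set Ioo_ae_eq_Icc]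
    exact hw.symm.trans (Lp.coeFn_zero ℂ 2 _)
  exact Measure.eqOn_Icc_of_ae_eq volume zero_ne_one h0 hf continuousOn_const hx

theorem targetGraph_snd_eq_zero (K c : ℝ) (p : StateSpace × StateSpace)
    (hp : p ∈ targetGraph K c) (h0 : p.1 = 0) : p.2 = 0 := by
  obtain ⟨v, z, a, h1, h2, -, -, h5, h6⟩ := hp
  rw [h0] at h1 h5 h6
  have hv : v = 0 := IsWeakDeriv.eq_zero h1
  subst hv
  have hz : z = 0 := h2.eq_zero
  have ha : a = 0 := HasValueAt.eq_zero (by simp) h5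
  rw [h6, hz, ha]
  simp

/-- The operator `A_w` of the target system, as an unbounded operator on the state space. -/
def targetOperator (K c : ℝ) : StateSpace →ₗ.[ℂ] StateSpace := (targetGraph K c).toLinearPMap

/-- The graph of `A_w` is `targetGraph`, so that no default value enters its definition. -/
theorem targetOperator_graph (K c : ℝ) : (targetOperator K c).graph = targetGraph K c :=
  Submodule.toLinearPMap_graph_eq _ (fun p hp h0 => targetGraph_snd_eq_zero K c p hp h0)

end

/-! The functions √2 cos(μₙx), μₙ = (n + 1/2)π, satisfy both boundary conditions and form an
orthonormal basis of L²(0,1). Together with e₀ = (1, 0) they give an orthonormal basis (eₙ) of the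
state space. The eigenvalues are -K, with eigenvector e₀, and λₙ = iμₙ² - c, with eigenvector eₙ₊₁ +
κₙe₀, where κₙ = √2/(λₙ + K). Here |λₙ + K| ≥ μₙ², so (κₙ) is square-summable.

Hence eigenvectors and orthonormal basis are quadratically close, and the map between them is x ↦ x
+ ⟪ψ, x⟫e₀ with ψ ⟂ e₀, whose inverse is x ↦ x - ⟪ψ, x⟫e₀. This is the Riesz basis property, with no
perturbation theorem needed.

In these coordinates the operator is exactly multiplication by the eigenvalues on its maximal domain
in ℓ² (`mem_targetGraph_iff`). Such an operator generates the semigroup of multiplications by e^{λt}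
(`EllTwo.tendsto_diagExp_iff`). All real parts are at most -min{K, c}, and conjugation by the
isomorphism costs only the constant M (`exists_semigroup_of_diagonal`). -/

/-! ### Diagonal semigroups on ℓ² -/

theorem Complex.norm_exp_sub_one_le_of_re_nonpos {z : ℂ} (hz : z.re ≤ 0) :
    ‖Complex.exp z - 1‖ ≤ ‖z‖ := by
  -- Mean value inequality on the convex half-plane Re ≤ 0, where the derivative of exp has norm at
  -- most 1.
  have h := (convex_halfSpace_re_le (0 : ℝ)).norm_image_sub_le_of_norm_hasDerivWithin_le
    (f := Complex.exp) (f' := Complex.exp) (C := 1) (x := 0) (y := z)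
    (fun x _ => (Complex.hasDerivAt_exp x).hasDerivWithinAt)
    (fun x hx => by
      rw [Complex.norm_exp, Real.exp_le_one_iff]
      exact hx) (by simp) hz
  simpa using h

/-- Abbreviation for the complex sequence space `ℓ²(ℕ)`. -/
abbrev EllTwo : Type := lp (fun _ : ℕ => ℂ) 2

theorem EllTwo.norm_sq_eq_tsum (x : EllTwo) : ‖x‖ ^ 2 = ∑' n, ‖x n‖ ^ 2 := by
  have := lp.norm_rpow_eq_tsum (p := 2) (by norm_num) x
  simpa using this

theorem EllTwo.summable_norm_sq (x : EllTwo) : Summable fun n => ‖x n‖ ^ 2 := by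
  have := (lp.memℓp x).summable (by norm_num)
  simpa using this

theorem memℓp_two_of_summable {f : ℕ → ℂ} (h : Summable fun n => ‖f n‖ ^ 2) :
    Memℓp (E := fun _ : ℕ => ℂ) f 2 :=
  memℓp_gen (by simpa using h)

theorem memℓp_two_of_norm_le {f g : ℕ → ℂ} (hg : Memℓp (E := fun _ : ℕ => ℂ) g 2)
    (h : ∀ n, ‖f n‖ ≤ ‖g n‖) : Memℓp (E := fun _ : ℕ => ℂ) f 2 := by
  refine memℓp_two_of_summable (.of_nonneg_of_le (fun n => by positivity) (fun n => ?_)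
    (EllTwo.summable_norm_sq ⟨g, hg⟩))
  exact pow_le_pow_left₀ (norm_nonneg _) (h n) 2

/-- Dominated convergence in `ℓ²`. -/
theorem EllTwo.tendsto_zero_of_dominated {l : Filter ℝ} {f : ℝ → EllTwo} (y : EllTwo)
    {C : ℝ} (hb : ∀ᶠ t in l, ∀ n, ‖f t n‖ ≤ C * ‖y n‖)
    (hf : ∀ n, Tendsto (fun t => f t n) l (𝓝 0)) : Tendsto f l (𝓝 0) := by
  have h : Tendsto (fun t => ∑' n, ‖f t n‖ ^ 2) l (𝓝 (∑' _ : ℕ, (0 : ℝ))) := by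
    refine tendsto_tsum_of_dominated_convergence
      ((EllTwo.summable_norm_sq y).mul_left (C ^ 2)) (fun n => ?_) ?_
    · simpa using ((hf n).norm.pow 2)
    · filter_upwards [hb] with t ht n
      rw [Real.norm_of_nonneg (by positivity), ← mul_pow]
      exact pow_le_pow_left₀ (norm_nonneg _) (ht n) 2
  rw [tendsto_zero_iff_norm_tendsto_zero]
  have h2 := (Real.continuous_sqrt.tendsto _).comp h
  simp only [tsum_zero, Real.sqrt_zero] at h2
  refine h2.congr fun t => ?_
  rw [Function.comp_apply, ← EllTwo.norm_sq_eq_tsum, Real.sqrt_sq (norm_nonneg _)]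

/-- The diagonal operator on `ℓ²` with bounded coefficients `m`. -/
noncomputable def EllTwo.diag (m : ℕ → ℂ) (C : ℝ) (hC : 0 ≤ C) (hm : ∀ n, ‖m n‖ ≤ C) :
    EllTwo →L[ℂ] EllTwo :=
  LinearMap.mkContinuous
    { toFun := fun x => ⟨fun n => m n * x n, memℓp_two_of_norm_le
        ((lp.memℓp x).const_mul (C : ℂ)) fun n => by
          rw [norm_mul, norm_mul, Complex.norm_of_nonneg hC]
          exact mul_le_mul_of_nonneg_right (hm n) (norm_nonneg _)⟩
      map_add' := fun x y => by ext n; exact mul_add _ _ _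
      map_smul' := fun a x => by ext n; exact mul_left_comm _ _ _ } C (fun x => by
    rw [← pow_le_pow_iff_left₀ (norm_nonneg _) (by positivity) two_ne_zero, mul_pow,
      EllTwo.norm_sq_eq_tsum, EllTwo.norm_sq_eq_tsum, ← tsum_mul_left]
    refine (EllTwo.summable_norm_sq _).tsum_le_tsum (fun n => ?_)
      ((EllTwo.summable_norm_sq x).mul_left _)
    rw [← mul_pow]
    refine pow_le_pow_left₀ (norm_nonneg _) ?_ 2
    exact (norm_mul _ _).trans_le (mul_le_mul_of_nonneg_right (hm n) (norm_nonneg _)))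

theorem EllTwo.diag_apply {m : ℕ → ℂ} {C : ℝ} (hC : 0 ≤ C) (hm : ∀ n, ‖m n‖ ≤ C) (x : EllTwo)
    (n : ℕ) : EllTwo.diag m C hC hm x n = m n * x n := rfl

theorem EllTwo.norm_diag_le {m : ℕ → ℂ} {C : ℝ} (hC : 0 ≤ C) (hm : ∀ n, ‖m n‖ ≤ C) :
    ‖EllTwo.diag m C hC hm‖ ≤ C :=
  LinearMap.mkContinuous_norm_le _ hC _

theorem EllTwo.tendsto_apply {l : Filter ℝ} {f : ℝ → EllTwo} {y : EllTwo}
    (h : Tendsto f l (𝓝 y)) (n : ℕ) : Tendsto (fun t => f t n) l (𝓝 (y n)) :=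
  ((lp.evalCLM ℂ (fun _ : ℕ => ℂ) 2 n).continuous.tendsto y).comp h

/-- The semigroup is indexed by all of ℝ, while e^{lt} need not be bounded in l for t < 0; `|t|`
gives a bounded operator for every t. -/
theorem norm_exp_mul_abs_le {l : ℂ} {α : ℝ} (hl : l.re ≤ -α) (t : ℝ) :
    ‖Complex.exp (l * (|t| : ℝ))‖ ≤ Real.exp (-α * |t|) := by
  rw [Complex.norm_exp, Real.exp_le_exp, Complex.re_mul_ofReal]
  exact mul_le_mul_of_nonneg_right hl (abs_nonneg t)

/-- The diagonal semigroup with the exponents `l`, extended evenly to negative times. -/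
noncomputable def EllTwo.diagExp (l : ℕ → ℂ) {α : ℝ} (hl : ∀ n, (l n).re ≤ -α) (t : ℝ) :
    EllTwo →L[ℂ] EllTwo :=
  EllTwo.diag (fun n => Complex.exp (l n * (|t| : ℝ))) (Real.exp (-α * |t|)) (Real.exp_nonneg _)
    fun n => norm_exp_mul_abs_le (hl n) t

section

variable {l : ℕ → ℂ} {α : ℝ} (hl : ∀ n, (l n).re ≤ -α)

theorem EllTwo.diagExp_apply {t : ℝ} (ht : 0 ≤ t) (x : EllTwo) (n : ℕ) :
    EllTwo.diagExp l hl t x n = Complex.exp (l n * t) * x n := by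
  rw [EllTwo.diagExp, EllTwo.diag_apply, abs_of_nonneg ht]

theorem EllTwo.norm_diagExp_le {t : ℝ} (ht : 0 ≤ t) :
    ‖EllTwo.diagExp l hl t‖ ≤ Real.exp (-α * t) := by
  conv_rhs => rw [← abs_of_nonneg ht]
  exact EllTwo.norm_diag_le _ _

theorem EllTwo.isC0Semigroup_diagExp (hα : 0 ≤ α) : IsC0Semigroup (EllTwo.diagExp l hl) where
  zero := by
    ext x n
    simp [EllTwo.diagExp_apply hl le_rfl]
  add s t hs ht := by
    ext x n
    rw [EllTwo.diagExp_apply hl (add_nonneg hs ht), ContinuousLinearMap.comp_apply,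
      EllTwo.diagExp_apply hl hs, EllTwo.diagExp_apply hl ht, ← mul_assoc, ← Complex.exp_add]
    push_cast
    ring_nf
  strong_cont x := by
    rw [← tendsto_sub_nhds_zero_iff]
    refine EllTwo.tendsto_zero_of_dominated x (C := 2) ?_ fun n => ?_
    · filter_upwards [self_mem_nhdsWithin] with t ht n
      have ht : 0 ≤ t := le_of_lt ht
      rw [lp.coeFn_sub, Pi.sub_apply, EllTwo.diagExp_apply hl ht]
      have h1 : ‖Complex.exp (l n * t)‖ ≤ 1 := by
        rw [Complex.norm_exp, Real.exp_le_one_iff, Complex.re_mul_ofReal]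
        exact mul_nonpos_of_nonpos_of_nonneg ((hl n).trans (by linarith)) ht
      calc ‖Complex.exp (l n * t) * x n - x n‖ ≤ ‖Complex.exp (l n * t) * x n‖ + ‖x n‖ :=
            norm_sub_le _ _
        _ ≤ 2 * ‖x n‖ := by
            rw [norm_mul, two_mul]
            gcongr
            exact mul_le_of_le_one_left (norm_nonneg _) h1
    · have h : Tendsto (fun t : ℝ => Complex.exp (l n * t) * x n - x n) (𝓝[>] 0)
          (𝓝 (Complex.exp (l n * (0 : ℝ)) * x n - x n)) := by
        refine tendsto_nhdsWithin_of_tendsto_nhds (Continuous.tendsto ?_ 0)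
        fun_prop
      simp only [Complex.ofReal_zero, mul_zero, Complex.exp_zero, one_mul, sub_self] at h
      refine h.congr' ?_
      filter_upwards [self_mem_nhdsWithin] with t ht
      rw [lp.coeFn_sub, Pi.sub_apply, EllTwo.diagExp_apply hl (le_of_lt ht)]

theorem tendsto_inv_smul_exp_sub (a b : ℂ) :
    Tendsto (fun t : ℝ => (t : ℂ)⁻¹ * (Complex.exp (a * t) * b - b)) (𝓝[>] 0) (𝓝 (a * b)) := by
  have h : HasDerivAt (fun t : ℝ => Complex.exp (a * t) * b) (a * b) 0 := by
    have h1 : HasDerivAt (fun t : ℝ => a * (t : ℂ)) a 0 := by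
      simpa using (Complex.ofRealCLM.hasDerivAt (x := (0 : ℝ))).const_mul a
    simpa using h1.cexp.mul_const b
  have h2 := h.tendsto_slope_zero_right
  simpa using h2

/-- The generator of the diagonal semigroup is the diagonal operator with its maximal domain. -/
theorem EllTwo.tendsto_diagExp_iff (hα : 0 ≤ α) (x y : EllTwo) :
    Tendsto (fun t : ℝ => ((t : ℂ)⁻¹) • (EllTwo.diagExp l hl t x - x)) (𝓝[>] 0) (𝓝 y) ↔
      ∀ n, y n = l n * x n := by
  have hcoord (n : ℕ) : Tendsto (fun t : ℝ => (((t : ℂ)⁻¹) • (EllTwo.diagExp l hl t x - x)) n)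
      (𝓝[>] 0) (𝓝 (l n * x n)) := by
    refine (tendsto_inv_smul_exp_sub (l n) (x n)).congr' ?_
    filter_upwards [self_mem_nhdsWithin] with t ht
    rw [lp.coeFn_smul, Pi.smul_apply, lp.coeFn_sub, Pi.sub_apply,
      EllTwo.diagExp_apply hl (le_of_lt ht), smul_eq_mul]
  -- A limit in ℓ² is determined by its coordinates. Conversely, the sequence y = (lₙxₙ), assumed to
  -- lie in ℓ², dominates the difference quotients, since |e^{lt} - 1| ≤ |l|t.
  refine ⟨fun h n => tendsto_nhds_unique (EllTwo.tendsto_apply h n) (hcoord n), fun h => ?_⟩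
  rw [← tendsto_sub_nhds_zero_iff]
  refine EllTwo.tendsto_zero_of_dominated y (C := 2) ?_ fun n => ?_
  · filter_upwards [self_mem_nhdsWithin] with t ht n
    have ht : 0 < t := ht
    rw [lp.coeFn_sub, Pi.sub_apply, lp.coeFn_smul, Pi.smul_apply, lp.coeFn_sub, Pi.sub_apply,
      EllTwo.diagExp_apply hl ht.le, smul_eq_mul]
    have h1 : ‖Complex.exp (l n * t) - 1‖ ≤ ‖l n * t‖ := by
      apply Complex.norm_exp_sub_one_le_of_re_nonpos
      rw [Complex.re_mul_ofReal]
      exact mul_nonpos_of_nonpos_of_nonneg ((hl n).trans (by linarith)) ht.le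
    have h2 : ‖(t : ℂ)⁻¹ * (Complex.exp (l n * t) * x n - x n)‖ ≤ ‖y n‖ := by
      rw [h n, ← sub_one_mul, norm_mul, norm_mul, norm_mul, norm_inv,
        Complex.norm_of_nonneg ht.le, inv_mul_le_iff₀ ht, ← mul_assoc]
      rw [norm_mul, Complex.norm_of_nonneg ht.le, mul_comm ‖l n‖] at h1
      exact mul_le_mul_of_nonneg_right h1 (norm_nonneg _)
    exact (norm_sub_le _ _).trans (by linarith)
  · have := (hcoord n).sub_const (y n)
    rw [← h n, sub_self] at this
    exact this

end

/-- A boundedly invertible image of a diagonal operator whose spectrum lies in the half-plane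
`Re z ≤ -α` generates a semigroup with decay rate `α`. -/
theorem exists_semigroup_of_diagonal {H : Type*} [NormedAddCommGroup H] [NormedSpace ℂ H]
    (S : EllTwo ≃L[ℂ] H) {l : ℕ → ℂ} {α : ℝ} (hα : 0 ≤ α) (hl : ∀ n, (l n).re ≤ -α) :
    ∃ T : ℝ → H →L[ℂ] H, IsC0Semigroup T ∧
      (∀ x y : H, Tendsto (fun t : ℝ => ((t : ℂ)⁻¹) • (T t x - x)) (𝓝[>] 0) (𝓝 y) ↔
        ∀ n, S.symm y n = l n * S.symm x n) ∧
      ∃ M : ℝ, 1 ≤ M ∧ ∀ t : ℝ, 0 ≤ t → ‖T t‖ ≤ M * Real.exp (-α * t) := by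
  have hD := EllTwo.isC0Semigroup_diagExp hl hα
  refine ⟨fun t => (S : EllTwo →L[ℂ] H).comp
    ((EllTwo.diagExp l hl t).comp (S.symm : H →L[ℂ] EllTwo)), ⟨?_, ?_, ?_⟩, fun x y => ?_,
    max 1 (‖(S : EllTwo →L[ℂ] H)‖ * ‖(S.symm : H →L[ℂ] EllTwo)‖), le_max_left _ _,
    fun t ht => ?_⟩
  · ext x
    simp [hD.zero]
  · intro s t hs ht
    ext x
    simp [hD.add s t hs ht]
  · intro x
    simpa [Function.comp_def] using (S.continuous.tendsto _).comp (hD.strong_cont (S.symm x))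
  · rw [← EllTwo.tendsto_diagExp_iff hl hα]
    constructor
    · intro h
      refine ((S.symm.continuous.tendsto _).comp h).congr fun t => ?_
      simp
    · intro h
      have h2 := (S.continuous.tendsto _).comp h
      rw [S.apply_symm_apply] at h2
      refine h2.congr fun t => ?_
      simp
  · calc _ ≤ ‖(S : EllTwo →L[ℂ] H)‖ * (‖EllTwo.diagExp l hl t‖ * ‖(S.symm : H →L[ℂ] EllTwo)‖) :=
          (ContinuousLinearMap.opNorm_comp_le _ _).trans
            (mul_le_mul_of_nonneg_left (ContinuousLinearMap.opNorm_comp_le _ _) (norm_nonneg _))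
      _ ≤ ‖(S : EllTwo →L[ℂ] H)‖ * (Real.exp (-α * t) * ‖(S.symm : H →L[ℂ] EllTwo)‖) := by
          gcongr
          exact EllTwo.norm_diagExp_le hl ht
      _ = (‖(S : EllTwo →L[ℂ] H)‖ * ‖(S.symm : H →L[ℂ] EllTwo)‖) * Real.exp (-α * t) := by ring
      _ ≤ _ := mul_le_mul_of_nonneg_right (le_max_right _ _) (Real.exp_nonneg _)

/-! ### Weak derivatives on (0,1) and primitives -/

theorem L2I.integrable (v : L2I) : Integrable v (volume.restrict (Ioo (0 : ℝ) 1)) :=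
  (Lp.memLp v).integrable (by norm_num)

theorem ContinuousOn.memLp_Ioo {f : ℝ → ℂ} (hf : ContinuousOn f (Icc 0 1)) :
    MemLp f 2 (volume.restrict (Ioo (0 : ℝ) 1)) := by
  obtain ⟨C, hC⟩ := isCompact_Icc.exists_bound_of_continuousOn hf
  refine MemLp.of_bound ((hf.mono Ioo_subset_Icc_self).aestronglyMeasurable measurableSet_Ioo) C ?_
  filter_upwards [ae_restrict_mem measurableSet_Ioo] with x hx
  exact hC x (Ioo_subset_Icc_self hx)

theorem Continuous.integrable_smul_Ioo {g : ℝ → ℝ} (hg : Continuous g) {v : ℝ → ℂ}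
    (hv : Integrable v (volume.restrict (Ioo (0 : ℝ) 1))) :
    Integrable (fun x => g x • v x) (volume.restrict (Ioo (0 : ℝ) 1)) := by
  obtain ⟨C, hC⟩ := isCompact_Icc.exists_bound_of_continuousOn (s := Icc (0 : ℝ) 1) hg.continuousOn
  refine hv.bdd_smul C hg.aestronglyMeasurable ?_
  filter_upwards [ae_restrict_mem measurableSet_Ioo] with x hx
  exact hC x (Ioo_subset_Icc_self hx)

/-- Since v is merely integrable, its primitive need not be differentiable everywhere; Fubini on the
triangle s < x replaces the product rule. -/
theorem setIntegral_Ioo_smul_primitive {g g' : ℝ → ℝ} (hg : ∀ x, HasDerivAt g (g' x) x)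
    (hg' : Continuous g') {v : ℝ → ℂ} (hv : Integrable v (volume.restrict (Ioo (0 : ℝ) 1))) :
    ∫ x in Ioo (0 : ℝ) 1, g' x • (∫ s in (0 : ℝ)..x, v s) =
      g 1 • (∫ s in (0 : ℝ)..1, v s) - ∫ x in Ioo (0 : ℝ) 1, g x • v x := by
  have hgc : Continuous g := continuous_iff_continuousAt.2 fun x => (hg x).continuousAt
  let F : ℝ → ℝ → ℂ := fun x s => {p : ℝ × ℝ | p.2 < p.1}.indicator
    (fun p : ℝ × ℝ => g' p.1 • v p.2) (x, s)
  have hmeas : MeasurableSet {p : ℝ × ℝ | p.2 < p.1} :=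
    measurableSet_lt measurable_snd measurable_fst
  have hint : Integrable (Function.uncurry F)
      ((volume.restrict (Ioo (0 : ℝ) 1)).prod (volume.restrict (Ioo (0 : ℝ) 1))) := by
    refine Integrable.indicator (Integrable.smul_prod (f := g') (g := v) ?_ hv) hmeas
    exact (hg'.integrableOn_Icc (a := 0) (b := 1)).mono_set Ioo_subset_Icc_self
  have h1 (x : ℝ) (hx : x ∈ Ioo (0 : ℝ) 1) :
      ∫ s in Ioo (0 : ℝ) 1, F x s = g' x • (∫ s in (0 : ℝ)..x, v s) := by
    have : F x = (Iio x).indicator (fun s => g' x • v s) := by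
      ext s; simp [F, indicator]
    rw [this, setIntegral_indicator measurableSet_Iio, Ioo_inter_Iio, min_eq_right hx.2.le,
      integral_smul, intervalIntegral.integral_of_le hx.1.le, integral_Ioc_eq_integral_Ioo]
  have h2 (s : ℝ) (hs : s ∈ Ioo (0 : ℝ) 1) :
      ∫ x in Ioo (0 : ℝ) 1, F x s = g 1 • v s - g s • v s := by
    have : (fun x => F x s) = (Ioi s).indicator (fun x => g' x • v s) := by
      ext x; simp [F, indicator]
    rw [this, setIntegral_indicator measurableSet_Ioi, Ioo_inter_Ioi, max_eq_right hs.1.le,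
      integral_smul_const, ← integral_Ioc_eq_integral_Ioo,
      ← intervalIntegral.integral_of_le hs.2.le,
      intervalIntegral.integral_eq_sub_of_hasDerivAt (fun x _ => hg x)
        (hg'.intervalIntegrable _ _), sub_smul]
  rw [← setIntegral_congr_fun measurableSet_Ioo h1, integral_integral_swap hint,
    setIntegral_congr_fun measurableSet_Ioo h2,
    integral_sub (f := fun s => g 1 • v s) (hv.smul (g 1)) (hgc.integrable_smul_Ioo hv),
    integral_smul,
    intervalIntegral.integral_of_le zero_le_one, integral_Ioc_eq_integral_Ioo]

/-- Integration by parts against an absolutely continuous function. -/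
theorem setIntegral_Ioo_smul_const_add_primitive {g g' : ℝ → ℝ}
    (hg : ∀ x, HasDerivAt g (g' x) x) (hg' : Continuous g') {v : ℝ → ℂ}
    (hv : Integrable v (volume.restrict (Ioo (0 : ℝ) 1))) (C : ℂ) :
    ∫ x in Ioo (0 : ℝ) 1, g' x • (C + ∫ s in (0 : ℝ)..x, v s) =
      g 1 • (C + ∫ s in (0 : ℝ)..1, v s) - g 0 • C - ∫ x in Ioo (0 : ℝ) 1, g x • v x := by
  have hvi : IntegrableOn v (uIcc (0 : ℝ) 1) := by
    rw [uIcc_of_le zero_le_one, integrableOn_Icc_iff_integrableOn_Ioo]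
    exact hv
  have hV : ContinuousOn (fun x => ∫ s in (0 : ℝ)..x, v s) (Icc 0 1) := by
    simpa [uIcc_of_le] using intervalIntegral.continuousOn_primitive_interval hvi
  have hVi : Integrable (fun x => ∫ s in (0 : ℝ)..x, v s) (volume.restrict (Ioo (0 : ℝ) 1)) :=
    hV.memLp_Ioo.integrable (by norm_num)
  simp_rw [smul_add]
  rw [integral_add (hg'.integrable_smul_Ioo (integrable_const C)) (hg'.integrable_smul_Ioo hVi),
    setIntegral_Ioo_smul_primitive hg hg' hv, integral_smul_const,
    ← integral_Ioc_eq_integral_Ioo, ← intervalIntegral.integral_of_le zero_le_one,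
    intervalIntegral.integral_eq_sub_of_hasDerivAt (fun x _ => hg x)
        (hg'.intervalIntegrable _ _), sub_smul]
  ring

theorem IsCompact.exists_subset_Icc_of_subset_Ioo {s : Set ℝ} (hs : IsCompact s) {a b : ℝ}
    (hab : a < b) (h : s ⊆ Ioo a b) : ∃ c d, a < c ∧ d < b ∧ s ⊆ Icc c d := by
  rcases s.eq_empty_or_nonempty with rfl | hne
  · exact ⟨(a + b) / 2, (a + b) / 2, by linarith, by linarith, by simp⟩
  · obtain ⟨c, hc⟩ := hs.exists_isLeast hne
    obtain ⟨d, hd⟩ := hs.exists_isGreatest hne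
    exact ⟨c, d, (h hc.1).1, (h hd.1).2, fun x hx => ⟨hc.2 hx, hd.2 hx⟩⟩

/-- A test function on `(0,1)` with vanishing integral is the derivative of a test function. -/
theorem exists_primitive_of_integral_eq_zero {χ : ℝ → ℝ} (hχ : ContDiff ℝ ∞ χ)
    (hs : HasCompactSupport χ) (ht : tsupport χ ⊆ Ioo (0 : ℝ) 1)
    (h0 : ∫ x in (0 : ℝ)..1, χ x = 0) :
    ∃ φ : ℝ → ℝ, ContDiff ℝ ∞ φ ∧ HasCompactSupport φ ∧ tsupport φ ⊆ Ioo (0 : ℝ) 1 ∧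
      deriv φ = χ := by
  obtain ⟨c, d, hc, hd, hcd⟩ := IsCompact.exists_subset_Icc_of_subset_Ioo hs zero_lt_one ht
  have hderiv (x : ℝ) : HasDerivAt (fun x => ∫ s in (0 : ℝ)..x, χ s) (χ x) x :=
    hχ.continuous.integral_hasStrictDerivAt 0 x |>.hasDerivAt
  have hd' : deriv (fun x => ∫ s in (0 : ℝ)..x, χ s) = χ := funext fun x => (hderiv x).deriv
  have hz (x : ℝ) (hx : x ∉ Icc c d) : χ x = 0 :=
    image_eq_zero_of_notMem_tsupport fun h => hx (hcd h)
  have hsupp : Function.support (fun x => ∫ s in (0 : ℝ)..x, χ s) ⊆ Icc c d := by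
    intro x hx
    by_contra hx'
    apply hx
    rcases lt_or_ge x c with hxc | hxc
    · refine intervalIntegral.integral_zero_ae (Eventually.of_forall fun s hs => hz s ?_)
      intro hs'
      rcases mem_uIoc.1 hs with h | h
      · linarith [hs'.1, h.2]
      · linarith [hs'.1, h.2]
    · have hxd : d < x := by
        by_contra h
        exact hx' ⟨hxc, not_lt.1 h⟩
      change ∫ s in (0 : ℝ)..x, χ s = 0
      -- Past d, subtracting the vanishing integral over [0,1] leaves an integral between 1 and x,
      -- where χ is zero.
      refine (sub_zero _).symm.trans ?_
      rw [show (∫ s in (0 : ℝ)..x, χ s) - 0 =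
        (∫ s in (0 : ℝ)..x, χ s) - ∫ s in (0 : ℝ)..1, χ s by rw [h0]]
      rw [intervalIntegral.integral_interval_sub_left
        (hχ.continuous.intervalIntegrable _ _) (hχ.continuous.intervalIntegrable _ _)]
      refine intervalIntegral.integral_zero_ae (Eventually.of_forall fun s hs => hz s ?_)
      intro hs'
      rcases mem_uIoc.1 hs with h | h
      · linarith [hs'.2, h.1]
      · linarith [hs'.2, h.1]
  have htsupp : tsupport (fun x => ∫ s in (0 : ℝ)..x, χ s) ⊆ Icc c d :=
    closure_minimal hsupp isClosed_Icc
  refine ⟨_, ?_, ?_, htsupp.trans fun x hx => ⟨hc.trans_le hx.1, hx.2.trans_lt hd⟩, hd'⟩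
  · rw [contDiff_infty_iff_deriv]
    refine ⟨fun x => (hderiv x).differentiableAt, ?_⟩
    rw [hd']
    exact hχ
  · exact isCompact_Icc.of_isClosed_subset (isClosed_tsupport _) htsupp

theorem exists_testFunction_integral_eq_one : ∃ η : ℝ → ℝ, ContDiff ℝ ∞ η ∧
    HasCompactSupport η ∧ tsupport η ⊆ Ioo (0 : ℝ) 1 ∧ ∫ x in (0 : ℝ)..1, η x = 1 := by
  let f : ContDiffBump (1 / 2 : ℝ) := ⟨1 / 8, 1 / 4, by norm_num, by norm_num⟩
  have hts : tsupport (f.normed volume) ⊆ Ioo (0 : ℝ) 1 := by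
    rw [f.tsupport_normed_eq]
    intro x hx
    have : |x - 1 / 2| ≤ 1 / 4 := hx
    rw [abs_le] at this
    constructor <;> linarith
  refine ⟨f.normed volume, f.contDiff_normed, f.hasCompactSupport_normed, hts, ?_⟩
  refine Eq.trans ?_ (f.integral_normed (μ := volume))
  rw [intervalIntegral.integral_of_le zero_le_one,
    setIntegral_eq_integral_of_forall_compl_eq_zero]
  exact fun x hx => image_eq_zero_of_notMem_tsupport fun h => hx (Ioo_subset_Ioc_self (hts h))

/-- The du Bois-Reymond lemma: a function with vanishing weak derivative is constant. -/
theorem ae_eq_const_of_weakDeriv_eq_zero {u : ℝ → ℂ}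
    (hu : Integrable u (volume.restrict (Ioo (0 : ℝ) 1)))
    (h : ∀ φ : ℝ → ℝ, ContDiff ℝ ∞ φ → HasCompactSupport φ → tsupport φ ⊆ Ioo (0 : ℝ) 1 →
      ∫ x in Ioo (0 : ℝ) 1, deriv φ x • u x = 0) :
    ∃ C : ℂ, u =ᵐ[volume.restrict (Ioo (0 : ℝ) 1)] fun _ => C := by
  obtain ⟨η, hη, hηs, hηt, hη1⟩ := exists_testFunction_integral_eq_one
  -- As η has integral 1, this is the only possible constant.
  refine ⟨∫ x in Ioo (0 : ℝ) 1, η x • u x, ?_⟩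
  set C := ∫ x in Ioo (0 : ℝ) 1, η x • u x with hC
  have hint : Integrable (fun x => u x - C) (volume.restrict (Ioo (0 : ℝ) 1)) :=
    hu.sub (integrable_const C)
  have hl : LocallyIntegrableOn (fun x => u x - C) (Ioo (0 : ℝ) 1) volume :=
    IntegrableOn.locallyIntegrableOn hint
  have key := isOpen_Ioo.ae_eq_zero_of_integral_contDiff_smul_eq_zero hl (fun χ hχ hχs hχt => by
    rw [← setIntegral_eq_integral_of_forall_compl_eq_zero (s := Ioo (0 : ℝ) 1)]
    swap
    · intro x hx
      rw [image_eq_zero_of_notMem_tsupport (fun hx' => hx (hχt hx')), zero_smul]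
    -- χ - mη has integral zero, so it is the derivative of a test function and integrates to zero
    -- against u.
    set m := ∫ x in (0 : ℝ)..1, χ x with hm
    obtain ⟨φ, h1, h2, h3, h4⟩ := exists_primitive_of_integral_eq_zero
      (χ := fun x => χ x - m * η x) (hχ.sub (contDiff_const.mul hη)) (hχs.sub hηs.mul_left)
      ((tsupport_sub _ _).trans (union_subset hχt
        ((tsupport_mul_subset_right (f := fun _ => m)).trans hηt))) (by
        rw [intervalIntegral.integral_sub (hχ.continuous.intervalIntegrable _ _)
          ((hη.continuous.const_mul m).intervalIntegrable _ _),
          intervalIntegral.integral_const_mul, hη1, ← hm, mul_one, sub_self])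
    have h5 := h φ h1 h2 h3
    simp_rw [h4, sub_smul, mul_smul] at h5
    rw [integral_sub (hχ.continuous.integrable_smul_Ioo hu)
      (g := fun x => m • η x • u x) ((hη.continuous.integrable_smul_Ioo hu).smul m),
      integral_smul, ← hC, sub_eq_zero] at h5
    simp_rw [smul_sub]
    rw [integral_sub (hχ.continuous.integrable_smul_Ioo hu)
      (hχ.continuous.integrable_smul_Ioo (integrable_const C)), h5, integral_smul_const,
      ← integral_Ioc_eq_integral_Ioo, ← intervalIntegral.integral_of_le zero_le_one, sub_self])
  have key2 := (ae_restrict_iff' measurableSet_Ioo).2 key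
  filter_upwards [key2] with x hx using sub_eq_zero.1 hx

/-- The function `x ↦ C + ∫₀ˣ v`. -/
noncomputable def primitiveFun (C : ℂ) (v : L2I) (x : ℝ) : ℂ := C + ∫ s in (0 : ℝ)..x, v s

theorem continuousOn_primitiveFun (C : ℂ) (v : L2I) :
    ContinuousOn (primitiveFun C v) (Icc 0 1) := by
  have hvi : IntegrableOn v (uIcc (0 : ℝ) 1) := by
    rw [uIcc_of_le zero_le_one, integrableOn_Icc_iff_integrableOn_Ioo]
    exact L2I.integrable v
  refine continuousOn_const.add ?_
  simpa [uIcc_of_le] using intervalIntegral.continuousOn_primitive_interval hvi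

/-- The function `x ↦ C + ∫₀ˣ v` as an element of `L²(0,1)`. -/
noncomputable def primitive (C : ℂ) (v : L2I) : L2I :=
  (continuousOn_primitiveFun C v).memLp_Ioo.toLp _

theorem coeFn_primitive (C : ℂ) (v : L2I) :
    primitive C v =ᵐ[volume.restrict (Ioo (0 : ℝ) 1)] primitiveFun C v :=
  MemLp.coeFn_toLp _

theorem primitiveFun_zero (C : ℂ) (v : L2I) : primitiveFun C v 0 = C := by
  simp [primitiveFun]

theorem integral_smul_primitive {g g' : ℝ → ℝ} (hg : ∀ x, HasDerivAt g (g' x) x)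
    (hg' : Continuous g') (C : ℂ) (v : L2I) :
    ∫ x in Ioo (0 : ℝ) 1, g' x • primitive C v x =
      g 1 • primitiveFun C v 1 - g 0 • C - ∫ x in Ioo (0 : ℝ) 1, g x • v x := by
  rw [primitiveFun, ← setIntegral_Ioo_smul_const_add_primitive hg hg' (L2I.integrable v) C]
  apply integral_congr_ae
  filter_upwards [coeFn_primitive C v] with x hx
  rw [hx, primitiveFun]

theorem isWeakDeriv_primitive (C : ℂ) (v : L2I) : IsWeakDeriv (primitive C v) v := by
  intro φ hφ hs ht
  have h0 : φ 0 = 0 := image_eq_zero_of_notMem_tsupport fun h => by simpa using ht h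
  have h1 : φ 1 = 0 := image_eq_zero_of_notMem_tsupport fun h => by simpa using ht h
  rw [integral_smul_primitive (g := φ)
    (fun x => ((hφ.differentiable (by simp)) x).hasDerivAt) (hφ.continuous_deriv (by simp)), h0, h1]
  simp

/-- The difference of w and the primitive of v has zero weak derivative, so it is constant. From
here on, Sobolev functions are handled as explicit primitives. -/
theorem IsWeakDeriv.exists_eq_primitive {w v : L2I} (h : IsWeakDeriv w v) :
    ∃ C, w = primitive C v := by
  have h0 := isWeakDeriv_primitive 0 v
  obtain ⟨C, hC⟩ := ae_eq_const_of_weakDeriv_eq_zero (u := fun x => w x - primitive 0 v x)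
    ((L2I.integrable w).sub (L2I.integrable _)) (fun φ hφ hs ht => by
      have hc := hφ.continuous_deriv (n := ∞) (by simp)
      simp_rw [smul_sub]
      rw [integral_sub (hc.integrable_smul_Ioo (L2I.integrable w))
        (hc.integrable_smul_Ioo (L2I.integrable _)), h φ hφ hs ht, h0 φ hφ hs ht, sub_self])
  refine ⟨C, Lp.ext ?_⟩
  filter_upwards [hC, coeFn_primitive 0 v, coeFn_primitive C v] with x h1 h2 h3
  rw [h3, primitiveFun, ← h1, h2, primitiveFun]
  ring

/-- Continuous functions that agree almost everywhere on [0,1] agree everywhere there, so boundary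
conditions become pointwise equations. -/
theorem hasValueAt_primitive_iff {C : ℂ} {v : L2I} {x : ℝ} (hx : x ∈ Icc (0 : ℝ) 1) {a : ℂ} :
    HasValueAt (primitive C v) x a ↔ primitiveFun C v x = a := by
  constructor
  · rintro ⟨f, hf, hw, rfl⟩
    have h0 : primitiveFun C v =ᵐ[volume.restrict (Icc (0 : ℝ) 1)] f := by
      rw [← Measure.restrict_congr_set Ioo_ae_eq_Icc]
      exact (coeFn_primitive C v).symm.trans hw
    exact Measure.eqOn_Icc_of_ae_eq volume zero_ne_one h0 (continuousOn_primitiveFun C v) hf hx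
  · intro h
    exact ⟨_, continuousOn_primitiveFun C v, coeFn_primitive C v, h⟩

/-! ### The cosine basis of L²(0,1) -/

/-- A continuous real function on `ℝ`, restricted to `(0,1)`, as an element of `L²(0,1)`. -/
noncomputable def L2I.ofContinuous (g : ℝ → ℝ) (hg : Continuous g) : L2I :=
  (Complex.continuous_ofReal.comp hg).continuousOn.memLp_Ioo.toLp _

theorem L2I.coeFn_ofContinuous {g : ℝ → ℝ} (hg : Continuous g) :
    L2I.ofContinuous g hg =ᵐ[volume.restrict (Ioo (0 : ℝ) 1)] fun x => (g x : ℂ) :=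
  MemLp.coeFn_toLp _

theorem L2I.inner_ofContinuous {g : ℝ → ℝ} (hg : Continuous g) (w : L2I) :
    inner ℂ (L2I.ofContinuous g hg) w = ∫ x in Ioo (0 : ℝ) 1, g x • w x := by
  rw [L2.inner_def]
  apply integral_congr_ae
  filter_upwards [L2I.coeFn_ofContinuous hg] with x hx
  rw [hx, RCLike.inner_apply, Complex.conj_ofReal, Complex.real_smul, mul_comm]

theorem L2I.inner_ofContinuous_ofContinuous {g h : ℝ → ℝ} (hg : Continuous g)
    (hh : Continuous h) :
    inner ℂ (L2I.ofContinuous g hg) (L2I.ofContinuous h hh) =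
      ((∫ x in (0 : ℝ)..1, g x * h x : ℝ) : ℂ) := by
  rw [L2I.inner_ofContinuous, intervalIntegral.integral_of_le zero_le_one,
    integral_Ioc_eq_integral_Ioo, ← integral_complex_ofReal]
  apply integral_congr_ae
  filter_upwards [L2I.coeFn_ofContinuous hh] with x hx
  rw [hx, Complex.real_smul, Complex.ofReal_mul]

/-- The frequencies `(n + 1/2) π`. -/
noncomputable def freq (n : ℕ) : ℝ := (n + 1 / 2) * Real.pi

theorem freq_pos (n : ℕ) : 0 < freq n := by unfold freq; positivity

theorem cos_freq (n : ℕ) : Real.cos (freq n) = 0 := by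
  rw [Real.cos_eq_zero_iff]
  exact ⟨n, by unfold freq; push_cast; ring⟩

/-- The functions `x ↦ √2 cos ((n + 1/2) π x)`. -/
noncomputable def cosMode (n : ℕ) (x : ℝ) : ℝ := √2 * Real.cos (freq n * x)

theorem continuous_cosMode (n : ℕ) : Continuous (cosMode n) := by unfold cosMode; fun_prop

theorem cosMode_one (n : ℕ) : cosMode n 1 = 0 := by rw [cosMode, mul_one, cos_freq, mul_zero]

theorem hasDerivAt_cosMode_div (n : ℕ) (x : ℝ) :
    HasDerivAt (fun x => cosMode n x / freq n ^ 2) (-(√2 * Real.sin (freq n * x) / freq n)) x := by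
  have h := ((((hasDerivAt_id x).const_mul (freq n)).cos).const_mul √2).div_const (freq n ^ 2)
  refine h.congr_deriv ?_
  have := (freq_pos n).ne'
  simp only [id, mul_one]
  field_simp

theorem hasDerivAt_sin_freq_div (n : ℕ) (x : ℝ) :
    HasDerivAt (fun x => √2 * Real.sin (freq n * x) / freq n) (cosMode n x) x := by
  have h := ((((hasDerivAt_id x).const_mul (freq n)).sin).const_mul √2).div_const (freq n)
  refine h.congr_deriv ?_
  have := (freq_pos n).ne'
  simp only [id, mul_one, cosMode]
  field_simp

theorem integral_cos_int_mul_pi (k : ℤ) :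
    ∫ x in (0 : ℝ)..1, Real.cos (k * Real.pi * x) = if k = 0 then 1 else 0 := by
  split_ifs with h
  · simp [h]
  · have h0 : (k : ℝ) * Real.pi ≠ 0 := mul_ne_zero (by exact_mod_cast h) Real.pi_ne_zero
    rw [intervalIntegral.integral_comp_mul_left (fun x => Real.cos x) h0, integral_cos]
    simp [Real.sin_int_mul_pi]

/-- Product-to-sum turns the product into cosines of frequencies (m - n)π and (m + n + 1)π; the
second is never zero. -/
theorem integral_cosMode_mul_cosMode (m n : ℕ) :
    ∫ x in (0 : ℝ)..1, cosMode m x * cosMode n x = if m = n then 1 else 0 := by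
  have h (x : ℝ) : cosMode m x * cosMode n x =
      Real.cos (((m : ℤ) - n : ℤ) * Real.pi * x) + Real.cos (((m : ℤ) + n + 1 : ℤ) * Real.pi * x) := by
    have e1 : (((m : ℤ) - n : ℤ) : ℝ) * Real.pi * x = freq m * x - freq n * x := by
      unfold freq; push_cast; ring
    have e2 : (((m : ℤ) + n + 1 : ℤ) : ℝ) * Real.pi * x = freq m * x + freq n * x := by
      unfold freq; push_cast; ring
    rw [e1, e2, Real.cos_add, Real.cos_sub]
    have h2 : √2 * √2 = 2 := Real.mul_self_sqrt (by norm_num)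
    unfold cosMode
    linear_combination (Real.cos (freq m * x) * Real.cos (freq n * x)) * h2
  simp_rw [h]
  rw [intervalIntegral.integral_add (Continuous.intervalIntegrable (by fun_prop) _ _)
    (Continuous.intervalIntegrable (by fun_prop) _ _), integral_cos_int_mul_pi,
    integral_cos_int_mul_pi, if_neg (by omega : ¬ ((m : ℤ) + n + 1 = 0)), add_zero]
  simp only [sub_eq_zero, Nat.cast_inj]

/-- The functions `cosMode n` as elements of `L²(0,1)`. -/
noncomputable def cosModeL2 (n : ℕ) : L2I := L2I.ofContinuous (cosMode n) (continuous_cosMode n)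

theorem inner_cosModeL2 (n : ℕ) (w : L2I) :
    inner ℂ (cosModeL2 n) w = ∫ x in Ioo (0 : ℝ) 1, cosMode n x • w x :=
  L2I.inner_ofContinuous _ w

theorem orthonormal_cosModeL2 : Orthonormal ℂ cosModeL2 := by
  rw [orthonormal_iff_ite]
  intro m n
  rw [cosModeL2, cosModeL2, L2I.inner_ofContinuous_ofContinuous, integral_cosMode_mul_cosMode]
  split_ifs <;> simp

/-- Multiplication by cos(πx) averages the two neighbouring modes. Below index 0 the neighbour has
frequency -π/2, which by evenness is mode 0 again. -/
theorem cos_pi_mul_cos_freq_zero (x : ℝ) :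
    Real.cos (Real.pi * x) * Real.cos (freq 0 * x) =
      (Real.cos (freq 1 * x) + Real.cos (freq 0 * x)) / 2 := by
  have e1 : freq 1 * x = Real.pi * x + freq 0 * x := by unfold freq; push_cast; ring
  have e2 : Real.cos (freq 0 * x) = Real.cos (Real.pi * x - freq 0 * x) := by
    congr 1; unfold freq; push_cast; ring
  rw [e1, Real.cos_add]
  rw [Real.cos_sub] at e2
  linarith

theorem cos_pi_mul_cos_freq_succ (n : ℕ) (x : ℝ) :
    Real.cos (Real.pi * x) * Real.cos (freq (n + 1) * x) =
      (Real.cos (freq (n + 2) * x) + Real.cos (freq n * x)) / 2 := by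
  have e1 : freq (n + 2) * x = freq (n + 1) * x + Real.pi * x := by unfold freq; push_cast; ring
  have e2 : freq n * x = freq (n + 1) * x - Real.pi * x := by unfold freq; push_cast; ring
  rw [e1, e2, Real.cos_add, Real.cos_sub]
  ring

theorem integral_cos_pow_mul_cos_freq_smul_eq_zero {w : ℝ → ℂ}
    (hw : Integrable w (volume.restrict (Ioo (0 : ℝ) 1)))
    (h : ∀ n, ∫ x in Ioo (0 : ℝ) 1, Real.cos (freq n * x) • w x = 0) (m n : ℕ) :
    ∫ x in Ioo (0 : ℝ) 1, (Real.cos (Real.pi * x) ^ m * Real.cos (freq n * x)) • w x = 0 := by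
  induction m generalizing n with
  | zero => simpa using h n
  | succ m ih =>
    have hint (k : ℕ) : Integrable (fun x => (Real.cos (Real.pi * x) ^ m * Real.cos (freq k * x)) •
        w x) (volume.restrict (Ioo (0 : ℝ) 1)) :=
      Continuous.integrable_smul_Ioo (by fun_prop) hw
    have key (j k : ℕ) (hjk : ∀ x, Real.cos (Real.pi * x) * Real.cos (freq n * x) =
        (Real.cos (freq j * x) + Real.cos (freq k * x)) / 2) :
        ∫ x in Ioo (0 : ℝ) 1, (Real.cos (Real.pi * x) ^ (m + 1) * Real.cos (freq n * x)) • w x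
          = 0 := by
      have e (x : ℝ) : (Real.cos (Real.pi * x) ^ (m + 1) * Real.cos (freq n * x)) • w x =
          (1 / 2 : ℝ) • ((Real.cos (Real.pi * x) ^ m * Real.cos (freq j * x)) • w x +
            (Real.cos (Real.pi * x) ^ m * Real.cos (freq k * x)) • w x) := by
        rw [pow_succ, mul_assoc, hjk, ← add_smul, smul_smul]
        congr 1
        ring
      simp_rw [e]
      rw [integral_smul, integral_add (hint j) (hint k), ih, ih, add_zero, smul_zero]
    cases n with
    | zero => exact key 1 0 cos_pi_mul_cos_freq_zero
    | succ n => exact key (n + 2) n (cos_pi_mul_cos_freq_succ n)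

theorem integral_polynomial_cos_smul_eq_zero {u : ℝ → ℂ}
    (hu : Integrable u (volume.restrict (Ioo (0 : ℝ) 1)))
    (h : ∀ m : ℕ, ∫ x in Ioo (0 : ℝ) 1, Real.cos (Real.pi * x) ^ m • u x = 0)
    (p : Polynomial ℝ) : ∫ x in Ioo (0 : ℝ) 1, p.eval (Real.cos (Real.pi * x)) • u x = 0 := by
  induction p using Polynomial.induction_on' with
  | add p q hp hq =>
    simp_rw [Polynomial.eval_add, add_smul]
    rw [integral_add (Continuous.integrable_smul_Ioo (by fun_prop) hu)
      (Continuous.integrable_smul_Ioo (by fun_prop) hu), hp, hq, add_zero]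
  | monomial m a =>
    simp_rw [Polynomial.eval_monomial, mul_smul]
    rw [integral_smul, h, smul_zero]

theorem integral_continuous_smul_eq_zero {u : ℝ → ℂ}
    (hu : Integrable u (volume.restrict (Ioo (0 : ℝ) 1)))
    (h : ∀ m : ℕ, ∫ x in Ioo (0 : ℝ) 1, Real.cos (Real.pi * x) ^ m • u x = 0)
    {φ : ℝ → ℝ} (hφ : Continuous φ) : ∫ x in Ioo (0 : ℝ) 1, φ x • u x = 0 := by
  set N := ∫ x in Ioo (0 : ℝ) 1, ‖u x‖ with hN
  have hN0 : 0 ≤ N := integral_nonneg fun _ => norm_nonneg _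
  have hb (ε : ℝ) (hε : 0 < ε) : ‖∫ x in Ioo (0 : ℝ) 1, φ x • u x‖ ≤ ε * N := by
    -- The substitution y = cos(πx) maps [0,1] homeomorphically onto [-1,1], so Weierstrass
    -- approximation makes polynomials in cos(πx) uniformly dense.
    obtain ⟨p, hp⟩ := exists_polynomial_near_of_continuousOn (-1) 1
      (fun y => φ (Real.arccos y / Real.pi)) (Continuous.continuousOn (by fun_prop)) ε hε
    have hd : ∫ x in Ioo (0 : ℝ) 1, φ x • u x =
        ∫ x in Ioo (0 : ℝ) 1, (φ x - p.eval (Real.cos (Real.pi * x))) • u x := by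
      simp_rw [sub_smul]
      rw [integral_sub (hφ.integrable_smul_Ioo hu)
        (Continuous.integrable_smul_Ioo (by fun_prop) hu),
        integral_polynomial_cos_smul_eq_zero hu h, sub_zero]
    rw [hd, hN, ← integral_const_mul]
    refine norm_integral_le_of_norm_le (hu.norm.const_mul ε) ?_
    filter_upwards [ae_restrict_mem measurableSet_Ioo] with x hx
    have h1 := hp (Real.cos (Real.pi * x)) (Real.cos_mem_Icc _)
    rw [Real.arccos_cos (mul_nonneg Real.pi_nonneg hx.1.le)
      (mul_le_of_le_one_right Real.pi_nonneg hx.2.le),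
      mul_div_cancel_left₀ _ Real.pi_ne_zero, abs_sub_comm] at h1
    rw [norm_smul]
    exact mul_le_mul_of_nonneg_right h1.le (norm_nonneg _)
  have h0 : ‖∫ x in Ioo (0 : ℝ) 1, φ x • u x‖ ≤ 0 := by
    refine le_of_forall_pos_le_add fun ε hε => ?_
    refine (hb (ε / (N + 1)) (by positivity)).trans ?_
    rw [zero_add, div_mul_eq_mul_div, div_le_iff₀ (by positivity)]
    nlinarith
  exact norm_le_zero_iff.1 h0

/-- If w is orthogonal to all modes, the averaging identity makes cos(πx/2)·w orthogonal to every
power of cos(πx), hence to every continuous function. So it vanishes almost everywhere, and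
cos(πx/2) > 0 on (0,1). -/
theorem L2I.eq_zero_of_inner_cosModeL2_eq_zero {w : L2I}
    (h : ∀ n, inner ℂ (cosModeL2 n) w = 0) : w = 0 := by
  have hw := L2I.integrable w
  have h1 (n : ℕ) : ∫ x in Ioo (0 : ℝ) 1, Real.cos (freq n * x) • w x = 0 := by
    have h2 := h n
    simp_rw [inner_cosModeL2, cosMode, mul_smul] at h2
    rw [integral_smul] at h2
    exact (smul_eq_zero.1 h2).resolve_left (by positivity)
  have hu : Integrable (fun x => Real.cos (freq 0 * x) • w x)
      (volume.restrict (Ioo (0 : ℝ) 1)) :=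
    Continuous.integrable_smul_Ioo (by fun_prop) hw
  have h3 (m : ℕ) : ∫ x in Ioo (0 : ℝ) 1, Real.cos (Real.pi * x) ^ m •
      (Real.cos (freq 0 * x) • w x) = 0 := by
    simp_rw [smul_smul]
    exact integral_cos_pow_mul_cos_freq_smul_eq_zero hw h1 m 0
  have hl : LocallyIntegrableOn (fun x => Real.cos (freq 0 * x) • w x) (Ioo (0 : ℝ) 1) volume :=
    IntegrableOn.locallyIntegrableOn hu
  have key := isOpen_Ioo.ae_eq_zero_of_integral_contDiff_smul_eq_zero hl (fun φ hφ hs ht => by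
    rw [← setIntegral_eq_integral_of_forall_compl_eq_zero (s := Ioo (0 : ℝ) 1)]
    · exact integral_continuous_smul_eq_zero hu h3 hφ.continuous
    · intro x hx
      rw [image_eq_zero_of_notMem_tsupport (fun hx' => hx (ht hx')), zero_smul])
  rw [Lp.eq_zero_iff_ae_eq_zero]
  filter_upwards [(ae_restrict_iff' measurableSet_Ioo).2 key,
    ae_restrict_mem measurableSet_Ioo] with x hx hxI
  refine (smul_eq_zero.1 hx).resolve_left (Real.cos_pos_of_mem_Ioo ⟨?_, ?_⟩).ne'
  · have := mul_pos (freq_pos 0) hxI.1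
    linarith [Real.pi_pos]
  · unfold freq
    have := mul_lt_mul_of_pos_left hxI.2 Real.pi_pos
    push_cast
    linarith

theorem orthogonal_span_cosModeL2 : (Submodule.span ℂ (range cosModeL2))ᗮ = ⊥ := by
  rw [Submodule.eq_bot_iff]
  intro w hw
  refine L2I.eq_zero_of_inner_cosModeL2_eq_zero fun n => ?_
  exact (Submodule.mem_orthogonal _ _).1 hw _ (Submodule.subset_span ⟨n, rfl⟩)

/-- The Hilbert basis `√2 cos ((n + 1/2) π x)` of `L²(0,1)`. -/
noncomputable def cosBasis : HilbertBasis ℕ ℂ L2I :=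
  HilbertBasis.mkOfOrthogonalEqBot orthonormal_cosModeL2 orthogonal_span_cosModeL2

theorem cosBasis_apply (n : ℕ) : cosBasis n = cosModeL2 n := by
  rw [cosBasis, HilbertBasis.coe_mkOfOrthogonalEqBot]

theorem cosBasis_repr_apply (w : L2I) (n : ℕ) :
    cosBasis.repr w n = ∫ x in Ioo (0 : ℝ) 1, cosMode n x • w x := by
  rw [HilbertBasis.repr_apply_apply, cosBasis_apply, inner_cosModeL2]

/-! ### The domain of the operator in cosine coefficients -/

/-- The function `x ↦ 1 - x` in `L²(0,1)`. -/
noncomputable def oneSub : L2I := L2I.ofContinuous (fun x => 1 - x) (by fun_prop)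

/-- Used twice: these coefficients dominate the couplings, giving square-summability without a
series estimate, and they expand w(0) in terms of w''. -/
theorem cosBasis_repr_oneSub (n : ℕ) :
    cosBasis.repr oneSub n = ((√2 / freq n ^ 2 : ℝ) : ℂ) := by
  rw [HilbertBasis.repr_apply_apply, cosBasis_apply, cosModeL2, oneSub,
    L2I.inner_ofContinuous_ofContinuous]
  congr 1
  have hd (x : ℝ) : HasDerivAt (fun x => (1 - x) * (√2 * Real.sin (freq n * x) / freq n) -
      cosMode n x / freq n ^ 2) (cosMode n x * (1 - x)) x := by
    refine ((((hasDerivAt_id x).const_sub 1).mul (hasDerivAt_sin_freq_div n x)).sub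
      (hasDerivAt_cosMode_div n x)).congr_deriv ?_
    simp only [id]
    ring
  have hc := continuous_cosMode n
  rw [intervalIntegral.integral_eq_sub_of_hasDerivAt (fun x _ => hd x)
    (Continuous.intervalIntegrable (by fun_prop) _ _), cosMode_one]
  simp [cosMode]

/-- Taylor's formula at 0 with integral remainder, for w(0) = a, w'(0) = 0, w'' = z. Under w(1) = 0
it gives w(0) = -⟪1 - x, w''⟫. -/
theorem primitiveFun_primitive_one (a : ℂ) (z : L2I) :
    primitiveFun a (primitive 0 z) 1 = a + inner ℂ oneSub z := by
  have h := integral_smul_primitive (g := fun x => x - 1) (g' := fun _ => 1)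
    (fun x => (hasDerivAt_id x).sub_const 1) continuous_const 0 z
  rw [primitiveFun, intervalIntegral.integral_of_le zero_le_one, integral_Ioc_eq_integral_Ioo]
  simp only [one_smul, sub_self, zero_smul, smul_zero, zero_sub] at h
  rw [h, oneSub, L2I.inner_ofContinuous, ← integral_neg]
  simp_rw [← neg_smul, neg_sub]

/-- Two integrations by parts; the boundary terms vanish because w(1) = 0, sin 0 = 0, `cosMode n 1 =
0` and w'(0) = 0. -/
theorem cosBasis_repr_primitive {a : ℂ} {z : L2I}
    (h1 : primitiveFun a (primitive 0 z) 1 = 0) (n : ℕ) :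
    cosBasis.repr (primitive a (primitive 0 z)) n =
      -((1 / freq n ^ 2 : ℝ) : ℂ) * cosBasis.repr z n := by
  rw [cosBasis_repr_apply, cosBasis_repr_apply,
    integral_smul_primitive (hasDerivAt_sin_freq_div n) (continuous_cosMode n), h1,
    integral_smul_primitive (g := fun x => -(cosMode n x / freq n ^ 2))
      (fun x => (hasDerivAt_cosMode_div n x).neg.congr_deriv (neg_neg _)) (by fun_prop)]
  simp only [cosMode_one, mul_zero, Real.sin_zero, zero_div, neg_zero, zero_smul, smul_zero,
    sub_self, zero_sub, neg_neg]
  rw [← integral_const_mul]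
  apply integral_congr_ae
  refine Eventually.of_forall fun x => ?_
  simp only [Complex.real_smul]
  push_cast
  ring

/-- The inner constant 0 encodes w'(0) = 0 and the outer constant is w(0), so only w(1) = 0 remains
as a condition. -/
theorem mem_targetGraph_iff_exists (K c : ℝ) (p q : StateSpace) :
    (p, q) ∈ targetGraph K c ↔ ∃ (z : L2I) (a : ℂ), primitiveFun a (primitive 0 z) 1 = 0 ∧
      p.snd = primitive a (primitive 0 z) ∧
      q = WithLp.toLp 2 (-(K : ℂ) * p.fst + a, -Complex.I • z - (c : ℂ) • p.snd) := by
  constructor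
  · rintro ⟨v, z, a, h1, h2, h3, h4, h5, h6⟩
    simp only at h1 h3 h5 h6
    obtain ⟨b, rfl⟩ := h2.exists_eq_primitive
    obtain ⟨d, hd⟩ := h1.exists_eq_primitive
    have hb : b = 0 := by
      rwa [hasValueAt_primitive_iff (by simp), primitiveFun_zero] at h4
    subst hb
    rw [hd, hasValueAt_primitive_iff (by simp), primitiveFun_zero] at h5
    subst h5
    rw [hd, hasValueAt_primitive_iff (by simp)] at h3
    exact ⟨z, d, h3, hd, h6⟩
  · rintro ⟨z, a, h1, h2, h3⟩
    refine ⟨primitive 0 z, z, a, ?_, isWeakDeriv_primitive _ _, ?_, ?_, ?_, h3⟩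
    · rw [h2]
      exact isWeakDeriv_primitive _ _
    · rwa [h2, hasValueAt_primitive_iff (by simp)]
    · rw [hasValueAt_primitive_iff (by simp), primitiveFun_zero]
    · rw [h2, hasValueAt_primitive_iff (by simp), primitiveFun_zero]

/-! ### Eigenvectors as a transvection of an orthonormal basis -/

/-- The vectors `(1, 0)`, `(0, cosMode 0)`, `(0, cosMode 1)`, … -/
noncomputable def stateMode : ℕ → StateSpace
  | 0 => WithLp.toLp 2 (1, 0)
  | n + 1 => WithLp.toLp 2 (0, cosModeL2 n)

theorem inner_stateMode_zero (p : StateSpace) : inner ℂ (stateMode 0) p = p.fst := by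
  simp [stateMode, WithLp.prod_inner_apply]

theorem inner_stateMode_succ (n : ℕ) (p : StateSpace) :
    inner ℂ (stateMode (n + 1)) p = inner ℂ (cosModeL2 n) p.snd := by
  simp [stateMode, WithLp.prod_inner_apply]

theorem orthonormal_stateMode : Orthonormal ℂ stateMode := by
  rw [orthonormal_iff_ite]
  intro m n
  rcases m with _ | m <;> rcases n with _ | n
  · rw [inner_stateMode_zero]; simp [stateMode]
  · rw [inner_stateMode_zero]; simp [stateMode]
  · rw [inner_stateMode_succ]; simp [stateMode]
  · rw [inner_stateMode_succ]
    simpa [stateMode] using orthonormal_iff_ite.1 orthonormal_cosModeL2 m n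

theorem orthogonal_span_stateMode : (Submodule.span ℂ (range stateMode))ᗮ = ⊥ := by
  rw [Submodule.eq_bot_iff]
  intro p hp
  have h (n : ℕ) : inner ℂ (stateMode n) p = 0 :=
    (Submodule.mem_orthogonal _ _).1 hp _ (Submodule.subset_span ⟨n, rfl⟩)
  have h0 : p.fst = 0 := by rw [← inner_stateMode_zero, h]
  have h1 : p.snd = 0 := L2I.eq_zero_of_inner_cosModeL2_eq_zero fun n => by
    rw [← inner_stateMode_succ, h]
  exact WithLp.ofLp_injective 2 (Prod.ext h0 h1)

/-- The Hilbert basis `(1, 0)`, `(0, cosMode 0)`, `(0, cosMode 1)`, … of the state space. -/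
noncomputable def stateBasis : HilbertBasis ℕ ℂ StateSpace :=
  HilbertBasis.mkOfOrthogonalEqBot orthonormal_stateMode orthogonal_span_stateMode

theorem stateBasis_apply (n : ℕ) : stateBasis n = stateMode n := by
  rw [stateBasis, HilbertBasis.coe_mkOfOrthogonalEqBot]

theorem stateBasis_repr_zero (p : StateSpace) : stateBasis.repr p 0 = p.fst := by
  rw [HilbertBasis.repr_apply_apply, stateBasis_apply, inner_stateMode_zero]

theorem stateBasis_repr_succ (p : StateSpace) (n : ℕ) :
    stateBasis.repr p (n + 1) = cosBasis.repr p.snd n := by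
  rw [HilbertBasis.repr_apply_apply, stateBasis_apply, inner_stateMode_succ,
    HilbertBasis.repr_apply_apply, cosBasis_apply]

theorem HilbertBasis.isOrthogonalBasis {H : Type*} [NormedAddCommGroup H]
    [InnerProductSpace ℂ H] (b : HilbertBasis ℕ ℂ H) : IsOrthogonalBasis b := by
  refine ⟨fun n => b.orthonormal.ne_zero n, fun m n h => b.orthonormal.2 h, ?_⟩
  rw [← dense_closure, ← Submodule.topologicalClosure_coe, b.dense_span]
  exact dense_univ

/-- The transvection `x ↦ x + ⟪ψ, x⟫ e` for orthogonal vectors `ψ` and `e`. -/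
noncomputable def innerTransvection {H : Type*} [NormedAddCommGroup H] [InnerProductSpace ℂ H]
    (ψ e : H) (h : inner ℂ ψ e = 0) : H ≃L[ℂ] H :=
  ContinuousLinearEquiv.equivOfInverse
    (ContinuousLinearMap.id ℂ H + (innerSL ℂ ψ).smulRight e)
    (ContinuousLinearMap.id ℂ H - (innerSL ℂ ψ).smulRight e)
    (fun x => by simp [inner_add_right, inner_smul_right, h])
    (fun x => by simp [inner_sub_right, inner_smul_right, h])

/-- The eigenvalues of the target operator. -/
noncomputable def targetEigenvalue (K c : ℝ) : ℕ → ℂ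
  | 0 => -K
  | n + 1 => Complex.I * (freq n ^ 2 : ℝ) - c

theorem targetEigenvalue_re_le (K c : ℝ) (n : ℕ) :
    (targetEigenvalue K c n).re ≤ -min K c := by
  cases n with
  | zero => simp [targetEigenvalue]
  | succ n =>
    rw [targetEigenvalue, Complex.sub_re, Complex.re_mul_ofReal]
    simp

/-- The imaginary part alone gives the bound. It shows both that the denominator of `coupling` is
nonzero and that the couplings decay. -/
theorem freq_sq_le_norm (K c : ℝ) (n : ℕ) :
    freq n ^ 2 ≤ ‖targetEigenvalue K c (n + 1) + K‖ := by
  have h : (targetEigenvalue K c (n + 1) + K).im = freq n ^ 2 := by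
    rw [targetEigenvalue, Complex.add_im, Complex.sub_im, Complex.im_mul_ofReal]
    simp
  rw [← h]
  exact (le_abs_self _).trans (Complex.abs_im_le_norm _)

/-- The first components of the eigenvectors of the target operator with the second components
`cosMode n`. -/
noncomputable def coupling (K c : ℝ) : ℕ → ℂ
  -- This value makes the coupling vector orthogonal to e₀, which the inverse of the transvection
  -- requires.
  | 0 => 0
  | n + 1 => √2 / (targetEigenvalue K c (n + 1) + K)

/-- The comparison sequence √2/μₙ² consists of the coefficients of 1 - x, so it lies in ℓ². The
`star` compensates for the conjugate-linear first argument of the inner product. -/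
theorem memℓp_coupling (K c : ℝ) :
    Memℓp (E := fun _ : ℕ => ℂ) (fun n => star (coupling K c n)) 2 := by
  refine memℓp_two_of_norm_le (lp.memℓp (stateBasis.repr (WithLp.toLp 2 (0, oneSub)))) fun n => ?_
  rw [norm_star]
  cases n with
  | zero => simp [coupling]
  | succ n =>
    have h0 : 0 < freq n ^ 2 := pow_pos (freq_pos n) 2
    rw [stateBasis_repr_succ, WithLp.toLp_snd, cosBasis_repr_oneSub, coupling, norm_div,
      Complex.norm_of_nonneg (by positivity), Complex.norm_of_nonneg (by positivity)]
    exact div_le_div_of_nonneg_left (by positivity) h0 (freq_sq_le_norm K c n)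

/-- The vector representing the functional `p ↦ ∑ coupling n * pₙ`. -/
noncomputable def couplingVector (K c : ℝ) : StateSpace :=
  stateBasis.repr.symm ⟨_, memℓp_coupling K c⟩

theorem hasSum_inner_couplingVector (K c : ℝ) (p : StateSpace) :
    HasSum (fun n => coupling K c n * stateBasis.repr p n) (inner ℂ (couplingVector K c) p) := by
  have h := lp.hasSum_inner (𝕜 := ℂ) (⟨_, memℓp_coupling K c⟩ : EllTwo) (stateBasis.repr p)
  rw [← stateBasis.repr.symm.inner_map_map, LinearIsometryEquiv.symm_apply_apply] at h
  have e : (fun n => coupling K c n * stateBasis.repr p n) =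
      fun n => inner ℂ (star (coupling K c n)) (stateBasis.repr p n) := by
    funext n
    rw [RCLike.inner_apply, starRingEnd_apply, star_star, mul_comm]
  rw [e]
  exact h

theorem inner_couplingVector_stateBasis (K c : ℝ) (n : ℕ) :
    inner ℂ (couplingVector K c) (stateBasis n) = coupling K c n := by
  refine (hasSum_inner_couplingVector K c _).unique ?_
  convert hasSum_ite_eq n (coupling K c n) using 2 with m
  rw [HilbertBasis.repr_self, lp.single_apply]
  by_cases h : m = n
  · subst h; simp
  · simp [h]

theorem inner_couplingVector_stateBasis_zero (K c : ℝ) :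
    inner ℂ (couplingVector K c) (stateBasis 0) = 0 := by
  rw [inner_couplingVector_stateBasis, coupling]

/-- The isomorphism that maps the standard basis of `ℓ²` to the eigenvectors. -/
noncomputable def eigenEquiv (K c : ℝ) : EllTwo ≃L[ℂ] StateSpace :=
  stateBasis.repr.symm.toContinuousLinearEquiv.trans
    (innerTransvection (couplingVector K c) (stateBasis 0)
      (inner_couplingVector_stateBasis_zero K c))

theorem eigenEquiv_single (K c : ℝ) (n : ℕ) :
    eigenEquiv K c (lp.single 2 n 1) = stateBasis n + coupling K c n • stateBasis 0 := by
  rw [← inner_couplingVector_stateBasis, ← stateBasis.repr_symm_single]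
  rfl

theorem eigenEquiv_symm_apply (K c : ℝ) (p : StateSpace) :
    (eigenEquiv K c).symm p =
      stateBasis.repr p - inner ℂ (couplingVector K c) p • lp.single 2 0 1 := by
  rw [← stateBasis.repr_self, ← map_smul, ← map_sub]
  rfl

theorem eigenEquiv_symm_apply_zero (K c : ℝ) (p : StateSpace) :
    (eigenEquiv K c).symm p 0 = p.fst - inner ℂ (couplingVector K c) p := by
  rw [eigenEquiv_symm_apply, lp.coeFn_sub, Pi.sub_apply, lp.coeFn_smul, Pi.smul_apply,
    lp.single_apply_self, stateBasis_repr_zero, smul_eq_mul, mul_one]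

theorem eigenEquiv_symm_apply_succ (K c : ℝ) (p : StateSpace) (n : ℕ) :
    (eigenEquiv K c).symm p (n + 1) = cosBasis.repr p.snd n := by
  rw [eigenEquiv_symm_apply, lp.coeFn_sub, Pi.sub_apply, lp.coeFn_smul, Pi.smul_apply,
    lp.single_apply_ne _ _ _ (Nat.succ_ne_zero n), stateBasis_repr_succ, smul_zero, sub_zero]

/-! ### Diagonalization of the operator -/

theorem cosBasis_repr_targetGraph {K c : ℝ} {p q : StateSpace} {z : L2I} {a : ℂ}
    (h1 : primitiveFun a (primitive 0 z) 1 = 0) (h2 : p.snd = primitive a (primitive 0 z))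
    (h3 : q = WithLp.toLp 2 (-(K : ℂ) * p.fst + a, -Complex.I • z - (c : ℂ) • p.snd)) (n : ℕ) :
    cosBasis.repr q.snd n = targetEigenvalue K c (n + 1) * cosBasis.repr p.snd n := by
  have hf : (freq n : ℂ) ≠ 0 := by exact_mod_cast (freq_pos n).ne'
  rw [h3, WithLp.toLp_snd, map_sub, map_smul, map_smul, lp.coeFn_sub, Pi.sub_apply,
    lp.coeFn_smul, lp.coeFn_smul, Pi.smul_apply, Pi.smul_apply, h2, cosBasis_repr_primitive h1,
    targetEigenvalue]
  push_cast
  simp only [smul_eq_mul]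
  field_simp
  ring

/-- Only coordinate 0 needs an argument beyond the cosine coefficients: it reduces to ⟪ψ, q⟫ + K⟪ψ,
p⟫ = w(0), with ψ the coupling vector. -/
theorem eigenEquiv_symm_of_mem_targetGraph {K c : ℝ} {p q : StateSpace}
    (h : (p, q) ∈ targetGraph K c) (n : ℕ) :
    (eigenEquiv K c).symm q n = targetEigenvalue K c n * (eigenEquiv K c).symm p n := by
  obtain ⟨z, a, h1, h2, h3⟩ := (mem_targetGraph_iff_exists K c p q).1 h
  cases n with
  | succ n =>
    rw [eigenEquiv_symm_apply_succ, eigenEquiv_symm_apply_succ]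
    exact cosBasis_repr_targetGraph h1 h2 h3 n
  | zero =>
    have hq : q.fst = -(K : ℂ) * p.fst + a := by rw [h3, WithLp.toLp_fst]
    have hs := (hasSum_inner_couplingVector K c q).add
      ((hasSum_inner_couplingVector K c p).mul_left (K : ℂ))
    have ha : HasSum (fun n => -(inner ℂ (WithLp.toLp 2 (0, oneSub) : StateSpace) (stateBasis n) *
        inner ℂ (stateBasis n) (WithLp.toLp 2 (0, z) : StateSpace))) a := by
      have h4 := (stateBasis.hasSum_inner_mul_inner (WithLp.toLp 2 (0, oneSub))
        (WithLp.toLp 2 (0, z))).neg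
      rw [WithLp.prod_inner_apply] at h4
      simp only [inner_zero_left, zero_add] at h4
      rw [primitiveFun_primitive_one] at h1
      rwa [eq_neg_of_add_eq_zero_left h1]
    -- Termwise, κₙ(λₙ + K) = √2 turns the left side into ∑ √2 wₙ, wₙ being the cosine coefficients
    -- of w. The series for -⟪1 - x, w''⟫ has the same terms, as w'' has coefficients -μₙ²wₙ.
    have hu : inner ℂ (couplingVector K c) q + K * inner ℂ (couplingVector K c) p = a := by
      refine hs.unique ?_
      convert ha using 2 with n
      rw [← inner_conj_symm _ (stateBasis n), ← HilbertBasis.repr_apply_apply,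
        ← HilbertBasis.repr_apply_apply]
      cases n with
      | zero => simp [coupling, stateBasis_repr_zero]
      | succ n =>
        have hf : (freq n : ℂ) ≠ 0 := by exact_mod_cast (freq_pos n).ne'
        have hne : targetEigenvalue K c (n + 1) + K ≠ 0 := by
          rw [← norm_pos_iff]
          exact (pow_pos (freq_pos n) 2).trans_le (freq_sq_le_norm K c n)
        simp only [stateBasis_repr_succ, WithLp.toLp_snd]
        rw [cosBasis_repr_oneSub, Complex.conj_ofReal, cosBasis_repr_targetGraph h1 h2 h3, h2,
          cosBasis_repr_primitive h1, coupling]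
        push_cast
        field_simp
        ring
    rw [eigenEquiv_symm_apply_zero, eigenEquiv_symm_apply_zero, targetEigenvalue, hq]
    linear_combination -hu

/-- In the coordinates of `eigenEquiv` the target operator is the maximal diagonal operator. -/
theorem mem_targetGraph_iff (K c : ℝ) (p q : StateSpace) :
    (p, q) ∈ targetGraph K c ↔
      ∀ n, (eigenEquiv K c).symm q n = targetEigenvalue K c n * (eigenEquiv K c).symm p n := by
  refine ⟨fun h n => eigenEquiv_symm_of_mem_targetGraph h n, fun h => ?_⟩
  -- The candidate for w'' is obtained by solving the second component for it; then w(1) = 0 forces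
  -- the value a of w(0).
  set z : L2I := Complex.I • (q.snd + (c : ℂ) • p.snd) with hz
  set a : ℂ := -inner ℂ oneSub z with ha
  have h1 : primitiveFun a (primitive 0 z) 1 = 0 := by
    rw [primitiveFun_primitive_one, ha, neg_add_cancel]
  have h2 : p.snd = primitive a (primitive 0 z) := by
    apply cosBasis.repr.injective
    ext n
    have hf : (freq n : ℂ) ≠ 0 := by exact_mod_cast (freq_pos n).ne'
    have hn := h (n + 1)
    rw [eigenEquiv_symm_apply_succ, eigenEquiv_symm_apply_succ] at hn
    rw [cosBasis_repr_primitive h1, hz, map_smul, map_add, map_smul, lp.coeFn_smul,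
      Pi.smul_apply, lp.coeFn_add, Pi.add_apply, lp.coeFn_smul, Pi.smul_apply, hn,
      targetEigenvalue]
    push_cast
    simp only [smul_eq_mul]
    field_simp
    ring_nf
    simp
  have h3 : (p, WithLp.toLp 2 (-(K : ℂ) * p.fst + a, -Complex.I • z - (c : ℂ) • p.snd)) ∈
      targetGraph K c := (mem_targetGraph_iff_exists K c _ _).2 ⟨z, a, h1, h2, rfl⟩
  -- Both sides have the coordinates of p multiplied by the eigenvalues: q by hypothesis, the other
  -- vector by the forward direction.
  have hq : q = WithLp.toLp 2 (-(K : ℂ) * p.fst + a, -Complex.I • z - (c : ℂ) • p.snd) := by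
    apply (eigenEquiv K c).symm.injective
    ext n
    rw [h, eigenEquiv_symm_of_mem_targetGraph h3]
  rwa [← hq] at h3

theorem isEigenvector_eigenEquiv_single (K c : ℝ) (n : ℕ) :
    IsEigenvector (targetOperator K c) (eigenEquiv K c (lp.single 2 n 1)) := by
  refine ⟨?_, ?_⟩
  · rw [Ne, (eigenEquiv K c).map_eq_zero_iff]
    intro h
    have := congrArg (fun x : EllTwo => x n) h
    simp at this
  · have h : (eigenEquiv K c (lp.single 2 n 1),
        targetEigenvalue K c n • eigenEquiv K c (lp.single 2 n 1)) ∈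
        (targetOperator K c).graph := by
      rw [targetOperator_graph, mem_targetGraph_iff]
      intro m
      rw [map_smul, ContinuousLinearEquiv.symm_apply_apply, lp.coeFn_smul, Pi.smul_apply,
        smul_eq_mul]
      by_cases hm : m = n
      · rw [hm]
      · rw [lp.single_apply_ne _ _ _ hm, mul_zero, mul_zero]
    obtain ⟨⟨y, hy⟩, hy1, hy2⟩ := (LinearPMap.mem_graph_iff _).1 h
    simp only at hy1 hy2
    subst hy1
    exact ⟨hy, _, hy2⟩

theorem summable_norm_sub_stateBasis (K c : ℝ) :
    Summable fun n => ‖eigenEquiv K c (lp.single 2 n 1) - stateBasis n‖ ^ 2 := by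
  refine (EllTwo.summable_norm_sq ⟨_, memℓp_coupling K c⟩).congr fun n => ?_
  rw [eigenEquiv_single, add_sub_cancel_left, norm_smul, stateBasis.orthonormal.1 0, mul_one,
    norm_star]

theorem lemma3 (K c : ℝ) (hK : 0 < K) (hc : 0 < c) :
    (∃ Z F : ℕ → StateSpace,
      (∀ n, IsEigenvector (targetOperator K c) (Z n)) ∧
      IsRieszBasis Z ∧
      IsOrthogonalBasis F ∧ Summable (fun n => ‖Z n - F n‖ ^ 2)) ∧
    (∃ T : ℝ → StateSpace →L[ℂ] StateSpace,
      IsC0Semigroup T ∧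
      IsInfinitesimalGenerator (targetOperator K c) T ∧
      ∃ M : ℝ, 1 ≤ M ∧ ∀ t : ℝ, 0 ≤ t → ‖T t‖ ≤ M * Real.exp (-(min K c) * t)) := by
  refine ⟨⟨fun n => eigenEquiv K c (lp.single 2 n 1), stateBasis,
    isEigenvector_eigenEquiv_single K c, ⟨eigenEquiv K c, fun _ => rfl⟩,
    stateBasis.isOrthogonalBasis, summable_norm_sub_stateBasis K c⟩, ?_⟩
  obtain ⟨T, hT, hgen, hM⟩ := exists_semigroup_of_diagonal (eigenEquiv K c)
    (le_min hK.le hc.le) (targetEigenvalue_re_le K c)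
  refine ⟨T, hT, fun x y => ?_, hM⟩
  rw [targetOperator_graph, mem_targetGraph_iff, hgen]
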